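/- Let $\ell^2=\ell^2(\mathbb N_0)$ be the complex Hilbert space with inner product antilinear in the first entry and canonical basis $\{\delta_j\}_{j\ge 0}$, and let $w=\sum_{j\ge1}w_j\delta_j\in\ell^2\ominus\{\delta_0\}$ with $w_j\in\mathbb C\setminus\{0\}$ for all $j\ge1$. A linear relation $T$ is a linear subset of $\ell^2\oplus\ell^2$; its adjoint is $T^*=\{(h,k):\langle k,f\rangle=\langle h,g\rangle\ \forall (f,g)\in T\}$, and $T$ is selfadjoint if $T=T^*$, positive if $\langle f,g\rangle\ge0$ for all $(f,g)\in T$, and quasi-null if $\langle f,g\rangle=0$ for all $(f,g)\in T$. With $T-\zeta I=\{(f,g-\zeta f):(f,g)\in T\}$, the spectrum $\sigma(T)$ is the set of $\zeta\in\mathbb C$ for which $(T-\zeta I)^{-1}$ is not a bounded operator defined on the whole space; $\sigma_d(T)$, resp. $\sigma_p^\infty(T)$, is the set of $\zeta$ for which $\ker(T-\zeta I)$ is nonzero of finite, resp. infinite, dimension (the multiplicity of the eigenvalue $\zeta$); and $\sigma_c(T)$ is the set of $\zeta$ for which $\operatorname{ran}(T-\zeta I)$ is not closed. Below, $\oplus$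 denotes an orthogonal sum and $\dotplus$ a direct sum of linear subsets of $\ell^2\oplus\ell^2$. Let $A=\{(f,\langle w,f\rangle\delta_0): f\in\ell^2\ominus\{\delta_0\}\}$ be the adjacency operator of the infinite directed star graph with weights $w$. (1) $A$ has exactly one positive selfadjoint extension. It is quasi-null and is given by $$S_1=A\oplus\operatorname{span}\{(w,-\delta_0)\}=0\!\upharpoonright_{\ell^2\ominus\{\delta_0\}}\oplus\operatorname{span}\{(0,\delta_0)\},$$ and $\sigma_p^\infty(S_1)=\sigma(S_1)=\{0\}$, $\sigma_c(S_1)=\emptyset$. (2) For every $\alpha\in\mathbb R\setminus\{0\}$, $$A_\alpha=A\dotplus\operatorname{span}\{(\delta_0+w/\alpha,\ \alpha\delta_0+w)\}$$ is the unique selfadjoint extension of $A$ having $\alpha$ as an eigenvalue. Moreover $\sigma_d(A_\alpha)=\{\alpha,-\|w\|^2/\alpha\}$, both of these eigenvalues have multiplicity one, $\sigma_p^\infty(A_\alpha)=\{0\}$, $\sigma_c(A_\alpha)=\emptyset$, and hence $\sigma(A_\alpha)=\{0,\alpha,-\|w\|^2/\alpha\}$. -/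

import Mathlib

noncomputable section

/-- A linear relation in the Hilbert space `H`: a (not necessarily closed) linear set of pairs
`(f, g)` in `H ⊕ H`. -/
abbrev LinRel (H : Type*) [NormedAddCommGroup H] [InnerProductSpace ℂ H] := Submodule ℂ (H × H)

namespace LinRel

section

variable {H : Type*} [NormedAddCommGroup H] [InnerProductSpace ℂ H]

/-- The domain of a relation. -/
def dom (T : LinRel H) : Submodule ℂ H := Submodule.map (LinearMap.fst ℂ H H) T

/-- The range of a relation. -/
def ran (T : LinRel H) : Submodule ℂ H := Submodule.map (LinearMap.snd ℂ H H) T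

/-- The kernel `{f | (f, 0) ∈ T}` of a relation. -/
def ker (T : LinRel H) : Submodule ℂ H := Submodule.comap (LinearMap.inl ℂ H H) T

/-- The inverse relation `{(g, f) | (f, g) ∈ T}`. -/
def inv (T : LinRel H) : LinRel H := Submodule.comap (LinearEquiv.prodComm ℂ H H).toLinearMap T

/-- The relation `T - ζ I = {(f, g - ζ f) | (f, g) ∈ T}`. -/
def subSmul (T : LinRel H) (ζ : ℂ) : LinRel H :=
  Submodule.map
    (LinearMap.prod (LinearMap.fst ℂ H H) (LinearMap.snd ℂ H H - ζ • LinearMap.fst ℂ H H)) T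

/-- A relation is selfadjoint if it equals its adjoint
`T* = {(h, k) | ⟪k, f⟫ = ⟪h, g⟫ for all (f, g) ∈ T}`. -/
def IsSelfadjoint (T : LinRel H) : Prop := Submodule.adjoint T = T

/-- A relation is positive if `⟪f, g⟫` is a nonnegative real number for all `(f, g) ∈ T`. -/
def IsPositive (T : LinRel H) : Prop :=
  ∀ p ∈ T, (inner ℂ p.1 p.2).im = 0 ∧ 0 ≤ (inner ℂ p.1 p.2).re

/-- A relation is quasi-null if `⟪f, g⟫ = 0` for all `(f, g) ∈ T`. -/
def IsQuasiNull (T : LinRel H) : Prop := ∀ p ∈ T, inner ℂ p.1 p.2 = 0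

/-- Orthogonality of two relations with respect to the inner product
`⟪f, h⟫ + ⟪g, k⟫` of `H ⊕ H`. -/
def IsOrtho (T S : LinRel H) : Prop :=
  ∀ p ∈ T, ∀ q ∈ S, inner ℂ p.1 q.1 + inner ℂ p.2 q.2 = 0

/-- `R = T ⊕ S`, an orthogonal sum. -/
def IsOrthogonalSum (R T S : LinRel H) : Prop := R = T ⊔ S ∧ IsOrtho T S

/-- `R = T ∔ S`, a direct sum. -/
def IsDirectSum (R T S : LinRel H) : Prop := R = T ⊔ S ∧ Disjoint T S

/-- A relation is bounded if `‖g‖ ≤ C ‖f‖` on it, for some constant `C > 0`; in particular it is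
then (the graph of) an operator. -/
def IsBdd (T : LinRel H) : Prop := ∃ C : ℝ, 0 < C ∧ ∀ p ∈ T, ‖p.2‖ ≤ C * ‖p.1‖

/-- The regular set: `(T - ζ I)⁻¹` is a bounded operator defined on the whole space. -/
def regularSet (T : LinRel H) : Set ℂ :=
  {ζ | (T.subSmul ζ).inv.IsBdd ∧ (T.subSmul ζ).inv.dom = ⊤}

/-- The spectrum. -/
def spec (T : LinRel H) : Set ℂ := T.regularSetᶜ

/-- The point spectrum. -/
def pointSpec (T : LinRel H) : Set ℂ := {ζ | (T.subSmul ζ).ker ≠ ⊥}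

/-- The discrete spectrum: eigenvalues of finite multiplicity. -/
def discreteSpec (T : LinRel H) : Set ℂ :=
  {ζ | ζ ∈ T.pointSpec ∧ FiniteDimensional ℂ (T.subSmul ζ).ker}

/-- The point non-discrete spectrum: eigenvalues of infinite multiplicity. -/
def infPointSpec (T : LinRel H) : Set ℂ :=
  {ζ | ζ ∈ T.pointSpec ∧ ¬ FiniteDimensional ℂ (T.subSmul ζ).ker}

/-- The continuous spectrum: `ran (T - ζ I)` is not closed. -/
def contSpec (T : LinRel H) : Set ℂ := {ζ | ¬ IsClosed ((T.subSmul ζ).ran : Set H)}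

end

end LinRel

/-- The Hilbert space `ℓ²` over the vertices `δ₀, δ₁, δ₂, …` of the star graph. -/
abbrev StarSpace : Type := lp (fun _ : ℕ => ℂ) 2

/-- The canonical basis vector (vertex) `δ_j`. -/
def starDelta (j : ℕ) : StarSpace := lp.single 2 j (1 : ℂ)

/-- The subspace `ℓ² ⊖ {δ₀}`. -/
def starLeaves : Submodule ℂ StarSpace := (Submodule.span ℂ {starDelta 0})ᗮ

/-- The adjacency operator `{(f, ⟪w, f⟫ δ₀) | f ∈ ℓ² ⊖ {δ₀}}` of the infinite directed star graph
with weights `w`. -/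
def starAdjacency (w : StarSpace) : LinRel StarSpace where
  carrier := {p | p.1 ∈ starLeaves ∧ p.2 = (inner ℂ w p.1 : ℂ) • starDelta 0}
  add_mem' := by
    rintro a b ⟨ha, ha'⟩ ⟨hb, hb'⟩
    exact ⟨add_mem ha hb, by simp [ha', hb', add_smul]⟩
  zero_mem' := by simp
  smul_mem' := by
    rintro c a ⟨ha, ha'⟩
    exact ⟨Submodule.smul_mem _ c ha, by simp [ha', mul_smul]⟩

/-- The zero operator with domain `ℓ² ⊖ {δ₀}`. -/
def starZero : LinRel StarSpace := starLeaves.prod ⊥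

/-- The relation `A + span {(w, -δ₀)}`. -/
def starExtPos (w : StarSpace) : LinRel StarSpace :=
  starAdjacency w ⊔ Submodule.span ℂ {(w, -starDelta 0)}

/-- The relation `A + span {(δ₀ + w / α, α δ₀ + w)}`. -/
def starExt (w : StarSpace) (α : ℝ) : LinRel StarSpace :=
  starAdjacency w ⊔
    Submodule.span ℂ {(starDelta 0 + (α : ℂ)⁻¹ • w, (α : ℂ) • starDelta 0 + w)}

end

/-! ### Linear relations: spectrum, selfadjointness, dimension of kernels -/

namespace LinRel

section

variable {H : Type*} [NormedAddCommGroup H] [InnerProductSpace ℂ H]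

/-! Write `e = δ₀`. Pairing with `A` forces every `(h, k)` in a selfadjoint extension to have `k =
⟪e, h⟫ w + c e` (`eq_of_starAdjacency_le`). Since a selfadjoint relation has no proper selfadjoint
extension, each uniqueness claim reduces to one inclusion.

Positivity: if some `a = ⟪e, h⟫` is nonzero, adding multiples of an element of `A` makes the
quadratic form affine in a real parameter with nonzero slope, hence somewhere negative. So all first
entries are orthogonal to `e`, which puts the extension inside `S₁ = {(f, c e) : f ⟂ e}`.

Eigenvalue `α ≠ 0`: the shape of `k` makes an eigenvector a multiple of `e + w/α`, so the extension
contains the generator of `A_α`. By `mem_starExt`, `A_α` is the graph of `f ↦ ⟪e, f⟫ w + (⟪w, f⟫ + β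
⟪e, f⟫) e` with `β = α - ‖w‖²/α`. This is a bounded symmetric operator acting through `span {e, w}`,
with characteristic polynomial `ζ² - βζ - ‖w‖² = (ζ - α)(ζ + ‖w‖²/α)`; its spectrum is read off from
explicit eigenvectors and an explicit resolvent. -/

theorem mem_subSmul {T : LinRel H} {ζ : ℂ} {f g : H} :
    (f, g) ∈ T.subSmul ζ ↔ (f, g + ζ • f) ∈ T := by
  constructor
  · rintro ⟨⟨a, b⟩, hab, h⟩
    obtain ⟨rfl, rfl⟩ : a = f ∧ b - ζ • a = g := Prod.mk.inj h
    simpa using hab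
  · intro h
    exact ⟨_, h, by simp⟩

theorem mem_ker_subSmul {T : LinRel H} {ζ : ℂ} {f : H} :
    f ∈ (T.subSmul ζ).ker ↔ (f, ζ • f) ∈ T := by
  have : f ∈ (T.subSmul ζ).ker ↔ (f, (0 : H)) ∈ T.subSmul ζ := Iff.rfl
  rw [this, mem_subSmul, zero_add]

theorem mem_ran_subSmul {T : LinRel H} {ζ : ℂ} {g : H} :
    g ∈ (T.subSmul ζ).ran ↔ ∃ f, (f, g + ζ • f) ∈ T := by
  constructor
  · rintro ⟨⟨a, b⟩, hab, rfl⟩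
    exact ⟨a, mem_subSmul.1 hab⟩
  · rintro ⟨f, hf⟩
    exact ⟨(f, g), mem_subSmul.2 hf, rfl⟩

theorem mem_pointSpec {T : LinRel H} {ζ : ℂ} :
    ζ ∈ T.pointSpec ↔ ∃ f, f ≠ 0 ∧ (f, ζ • f) ∈ T := by
  have : ζ ∈ T.pointSpec ↔ (T.subSmul ζ).ker ≠ ⊥ := Iff.rfl
  rw [this, Submodule.ne_bot_iff]
  simp only [mem_ker_subSmul, and_comm]

/-- A bounded operator inverting `T - ζ I` witnesses that `ζ` is regular. -/
theorem mem_regularSet_of_inverse {T : LinRel H} {ζ : ℂ} (R : H →L[ℂ] H)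
    (hleft : ∀ f g, (f, g + ζ • f) ∈ T → f = R g) (hright : ∀ g, (R g, g + ζ • R g) ∈ T) :
    ζ ∈ T.regularSet := by
  refine ⟨⟨‖R‖ + 1, by positivity, ?_⟩, ?_⟩
  · rintro ⟨g, f⟩ hp
    have hp' : (f, g) ∈ T.subSmul ζ := hp
    rw [hleft f g (mem_subSmul.1 hp')]
    calc ‖R g‖ ≤ ‖R‖ * ‖g‖ := R.le_opNorm g
      _ ≤ (‖R‖ + 1) * ‖g‖ := by gcongr; linarith
  · rw [eq_top_iff]
    intro g _
    have h : (R g, g) ∈ T.subSmul ζ := mem_subSmul.2 (hright g)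
    exact ⟨(g, R g), h, rfl⟩

theorem pointSpec_subset_spec (T : LinRel H) : T.pointSpec ⊆ T.spec := by
  intro ζ hζ hreg
  obtain ⟨f, hf, hfT⟩ := mem_pointSpec.1 hζ
  obtain ⟨C, _, hC⟩ := hreg.1
  have h : (f, (0 : H)) ∈ T.subSmul ζ := mem_subSmul.2 (by simpa using hfT)
  have := hC (0, f) h
  exact hf (by simpa using this)

theorem ran_eq_top_of_mem_regularSet {T : LinRel H} {ζ : ℂ} (h : ζ ∈ T.regularSet) :
    (T.subSmul ζ).ran = ⊤ := by
  rw [eq_top_iff, ← h.2]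
  rintro g ⟨⟨a, b⟩, hab, rfl⟩
  exact ⟨(b, a), hab, rfl⟩

theorem isSelfadjoint_iff {T : LinRel H} : T.IsSelfadjoint ↔
    ∀ h k : H, (h, k) ∈ T ↔ ∀ f g, (f, g) ∈ T → (inner ℂ g h : ℂ) = inner ℂ f k := by
  simp only [IsSelfadjoint, SetLike.ext_iff, Prod.forall, Submodule.mem_adjoint_iff, sub_eq_zero]
  exact forall₂_congr fun _ _ => Iff.comm

theorem IsSelfadjoint.inner_eq {T : LinRel H} (hT : T.IsSelfadjoint) {f g h k : H}
    (hfg : (f, g) ∈ T) (hhk : (h, k) ∈ T) : (inner ℂ g h : ℂ) = inner ℂ f k :=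
  (isSelfadjoint_iff.1 hT h k).1 hhk f g hfg

/-- Selfadjoint relations are maximal symmetric. -/
theorem IsSelfadjoint.eq_of_le {T S : LinRel H} (hT : T.IsSelfadjoint) (hS : S.IsSelfadjoint)
    (h : T ≤ S) : S = T := by
  refine le_antisymm ?_ h
  rintro ⟨a, b⟩ hab
  -- `S` is symmetric and contains `T`, so `S ⊆ T* = T`.
  exact (isSelfadjoint_iff.1 hT a b).2 fun f g hfg => hS.inner_eq (h hfg) hab

/-- In an infinite-dimensional space, a subspace containing the orthogonal complement of a
finite-dimensional subspace is infinite-dimensional. -/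
theorem _root_.Submodule.not_finiteDimensional_of_orthogonal_le
    (hH : ¬ FiniteDimensional ℂ H) {M K : Submodule ℂ H} [FiniteDimensional ℂ M] (h : Mᗮ ≤ K) :
    ¬ FiniteDimensional ℂ K := by
  intro hK
  have htop : M ⊔ K = ⊤ := by
    rw [eq_top_iff, ← Submodule.sup_orthogonal_of_hasOrthogonalProjection (K := M)]
    exact sup_le_sup_left h M
  have : FiniteDimensional ℂ (M ⊔ K : Submodule ℂ H) := inferInstance
  rw [htop] at this
  exact hH (Module.finite_def.2 (Module.Finite.iff_fg.1 this))

end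

end LinRel

/-! ### The canonical basis and the adjacency operator -/

theorem norm_starDelta (j : ℕ) : ‖starDelta j‖ = 1 := by
  simp [starDelta, lp.norm_single]

theorem inner_starDelta (j : ℕ) (f : StarSpace) : (inner ℂ (starDelta j) f : ℂ) = f j := by
  simp [starDelta, lp.inner_single_left]

theorem inner_starDelta_self (j : ℕ) : (inner ℂ (starDelta j) (starDelta j) : ℂ) = 1 := by
  rw [inner_self_eq_norm_sq_to_K, norm_starDelta]; simp

theorem orthonormal_starDelta : Orthonormal ℂ starDelta := by
  refine ⟨norm_starDelta, fun i j hij => ?_⟩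
  refine (inner_starDelta i _).trans ?_
  exact lp.single_apply_ne _ _ _ hij

theorem not_finiteDimensional_starSpace : ¬ FiniteDimensional ℂ StarSpace := by
  intro h
  have : Finite ℕ := orthonormal_starDelta.linearIndependent.finite
  exact not_finite ℕ

theorem mem_starLeaves {f : StarSpace} : f ∈ starLeaves ↔ (inner ℂ (starDelta 0) f : ℂ) = 0 :=
  Submodule.mem_orthogonal_singleton_iff_inner_right

theorem mem_starAdjacency {w f g : StarSpace} : (f, g) ∈ starAdjacency w ↔
    (inner ℂ (starDelta 0) f : ℂ) = 0 ∧ g = (inner ℂ w f : ℂ) • starDelta 0 := by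
  rw [← mem_starLeaves]; rfl

/-- Shape of the elements of the adjoint of the adjacency operator. -/
theorem eq_of_starAdjacency_le {w : StarSpace} {S : LinRel StarSpace}
    (hAS : starAdjacency w ≤ S) (hS : S.IsSelfadjoint) {h k : StarSpace} (hk : (h, k) ∈ S) :
    ∃ c : ℂ, k = (inner ℂ (starDelta 0) h : ℂ) • w + c • starDelta 0 := by
  set e := starDelta 0 with he
  have hmem : k - (inner ℂ e h : ℂ) • w ∈ (Submodule.span ℂ {e})ᗮᗮ := by
    rw [Submodule.mem_orthogonal]
    intro f hf
    have := hS.inner_eq (hAS (mem_starAdjacency.2 ⟨mem_starLeaves.1 hf, rfl⟩)) hk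
    rw [inner_sub_right, ← this, inner_smul_left, inner_smul_right, inner_conj_symm, ← he]
    ring
  rw [Submodule.orthogonal_orthogonal, Submodule.mem_span_singleton] at hmem
  obtain ⟨c, hc⟩ := hmem
  exact ⟨c, by rw [hc]; abel⟩

/-! ### The positive extension `S₁` -/

section

variable {w : StarSpace}

theorem inner_starDelta_zero_of_apply_eq_zero (hw0 : w 0 = 0) :
    (inner ℂ (starDelta 0) w : ℂ) = 0 ∧ (inner ℂ w (starDelta 0) : ℂ) = 0 := by
  have h : (inner ℂ (starDelta 0) w : ℂ) = 0 := by rw [inner_starDelta, hw0]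
  exact ⟨h, inner_eq_zero_symm.1 h⟩

theorem mem_starExtPos (hw0 : w 0 = 0) {f g : StarSpace} : (f, g) ∈ starExtPos w ↔
    (inner ℂ (starDelta 0) f : ℂ) = 0 ∧ ∃ c : ℂ, g = c • starDelta 0 := by
  obtain ⟨h1, h2⟩ := inner_starDelta_zero_of_apply_eq_zero hw0
  have hN := inner_self_eq_norm_sq_to_K (𝕜 := ℂ) w
  rw [starExtPos, Submodule.mem_sup]
  constructor
  · rintro ⟨⟨a, b⟩, hab, y, hy, hfg⟩
    obtain ⟨t, rfl⟩ := Submodule.mem_span_singleton.1 hy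
    obtain ⟨ha, rfl⟩ := mem_starAdjacency.1 hab
    simp only [Prod.smul_mk, Prod.mk_add_mk, Prod.mk.injEq] at hfg
    obtain ⟨rfl, rfl⟩ := hfg
    refine ⟨by rw [inner_add_right, inner_smul_right, ha, h1]; simp, inner ℂ w a - t, ?_⟩
    module
  · rintro ⟨hf, c, rfl⟩
    have hD : (1 + (‖w‖ : ℂ) ^ 2) ≠ 0 := by
      have : (1 + ‖w‖ ^ 2 : ℝ) ≠ 0 := by positivity
      exact_mod_cast this
    -- The coefficient of the orthogonal projection of `(f, c δ₀)` onto `(w, -δ₀)`.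
    set t : ℂ := (inner ℂ w f - c) / (1 + (‖w‖ : ℂ) ^ 2) with ht
    refine ⟨(f - t • w, (inner ℂ w (f - t • w) : ℂ) • starDelta 0),
      mem_starAdjacency.2 ⟨by rw [inner_sub_right, inner_smul_right, hf, h1]; simp, rfl⟩,
      _, Submodule.mem_span_singleton.2 ⟨t, rfl⟩, ?_⟩
    have htD : t * (1 + (‖w‖ : ℂ) ^ 2) = inner ℂ w f - c := div_mul_cancel₀ _ hD
    simp only [Prod.smul_mk, Prod.mk_add_mk, Prod.mk.injEq, sub_add_cancel, true_and]
    rw [inner_sub_right, inner_smul_right, hN]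
    have : (inner ℂ w f : ℂ) - t * (‖w‖ : ℂ) ^ 2 = c + t := by linear_combination -htD
    erw [this]
    module

theorem isSelfadjoint_starExtPos (hw0 : w 0 = 0) : (starExtPos w).IsSelfadjoint := by
  rw [LinRel.isSelfadjoint_iff]
  intro h k
  rw [mem_starExtPos hw0]
  constructor
  · rintro ⟨hh, c, rfl⟩ f g hfg
    obtain ⟨hf, d, rfl⟩ := (mem_starExtPos hw0).1 hfg
    rw [inner_smul_left, inner_smul_right, hh, inner_eq_zero_symm.1 hf]; simp
  · intro H
    constructor
    · simpa using H 0 (starDelta 0) ((mem_starExtPos hw0).2 ⟨by simp, 1, by simp⟩)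
    · have hmem : k ∈ (Submodule.span ℂ {starDelta 0})ᗮᗮ := by
        rw [Submodule.mem_orthogonal]
        intro f hf
        simpa using (H f 0 ((mem_starExtPos hw0).2 ⟨mem_starLeaves.1 hf, 0, by simp⟩)).symm
      rw [Submodule.orthogonal_orthogonal, Submodule.mem_span_singleton] at hmem
      obtain ⟨c, hc⟩ := hmem
      exact ⟨c, hc.symm⟩

theorem isQuasiNull_starExtPos (hw0 : w 0 = 0) : (starExtPos w).IsQuasiNull := by
  rintro ⟨f, g⟩ hp
  obtain ⟨hf, c, rfl⟩ := (mem_starExtPos hw0).1 hp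
  rw [inner_smul_right, inner_eq_zero_symm.1 hf, mul_zero]

theorem eq_starExtPos_of_isPositive (hw0 : w 0 = 0) (hw : w ≠ 0) {S : LinRel StarSpace}
    (hAS : starAdjacency w ≤ S) (hS : S.IsSelfadjoint) (hpos : S.IsPositive) :
    S = starExtPos w := by
  obtain ⟨h1, h2⟩ := inner_starDelta_zero_of_apply_eq_zero hw0
  refine (hS.eq_of_le (isSelfadjoint_starExtPos hw0) ?_).symm
  rintro ⟨h, k⟩ hk
  obtain ⟨c, hc⟩ := eq_of_starAdjacency_le hAS hS hk
  suffices ha : (inner ℂ (starDelta 0) h : ℂ) = 0 by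
    refine (mem_starExtPos hw0).2 ⟨ha, c, ?_⟩
    rw [hc, ha]; simp
  by_contra ha
  set e := starDelta 0 with he
  have hee : (inner ℂ e e : ℂ) = 1 := inner_starDelta_self 0
  set a : ℂ := inner ℂ e h with hadef
  -- the pair `(a e, a w + d e)` belongs to `S`
  have hsub : (h - a • e, (inner ℂ w (h - a • e) : ℂ) • e) ∈ S :=
    hAS (mem_starAdjacency.2 ⟨by
      rw [← he, inner_sub_right, inner_smul_right, hee, ← hadef]; ring, rfl⟩)
  obtain ⟨d, hd⟩ : ∃ d : ℂ, (a • e, a • w + d • e) ∈ S := by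
    refine ⟨c - inner ℂ w (h - a • e), ?_⟩
    have := S.sub_mem hk hsub
    rw [Prod.mk_sub_mk, hc] at this
    convert this using 2
    · abel
    · module
  -- Adding `(t a w, t a ‖w‖² e) ∈ A` to that pair creates only cross terms, so the form is affine
  -- in `t`.
  have key : ∀ t : ℝ, 0 ≤ (starRingEnd ℂ a * d).re + t * (2 * (‖a‖ ^ 2 * ‖w‖ ^ 2)) := by
    intro t
    have hA : (((t : ℂ) * a) • w, (inner ℂ w (((t : ℂ) * a) • w) : ℂ) • e) ∈ S :=
      hAS (mem_starAdjacency.2 ⟨by rw [inner_smul_right, h1, mul_zero], rfl⟩)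
    have := (hpos _ (S.add_mem hd hA)).2
    simp only [Prod.mk_add_mk, inner_add_left, inner_add_right, inner_smul_left, inner_smul_right,
      h1, h2, hee, inner_self_eq_norm_sq_to_K (𝕜 := ℂ) w] at this
    convert this using 1
    have h3 : (starRingEnd ℂ) a * a = ((‖a‖ ^ 2 : ℝ) : ℂ) := by
      rw [mul_comm, Complex.mul_conj, Complex.normSq_eq_norm_sq]
    have h4 : ((starRingEnd ℂ a * d) + ((t * (2 * (‖a‖ ^ 2 * ‖w‖ ^ 2)) : ℝ) : ℂ)).re =
      (starRingEnd ℂ a * d).re + t * (2 * (‖a‖ ^ 2 * ‖w‖ ^ 2)) := by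
        rw [Complex.add_re, Complex.ofReal_re]
    rw [← h4]
    congr 1
    push_cast at h3 ⊢
    simp only [map_mul, Complex.conj_ofReal]
    linear_combination (-2 * (t : ℂ) * (‖w‖ : ℂ) ^ 2) * h3
  have hP : 0 < 2 * (‖a‖ ^ 2 * ‖w‖ ^ 2) := by
    have := norm_pos_iff.2 ha
    have := norm_pos_iff.2 hw
    positivity
  -- This `t` gives the form the value `-1`.
  have := key (-((starRingEnd ℂ a * d).re + 1) / (2 * (‖a‖ ^ 2 * ‖w‖ ^ 2)))
  rw [div_mul_cancel₀ _ hP.ne'] at this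
  linarith

theorem isOrthogonalSum_starExtPos_starAdjacency (w : StarSpace) :
    LinRel.IsOrthogonalSum (starExtPos w) (starAdjacency w)
      (Submodule.span ℂ {(w, -starDelta 0)}) := by
  refine ⟨rfl, ?_⟩
  rintro ⟨f, g⟩ hp q hq
  obtain ⟨t, rfl⟩ := Submodule.mem_span_singleton.1 hq
  obtain ⟨hf, rfl⟩ := mem_starAdjacency.1 hp
  simp only [Prod.smul_mk, inner_smul_right, inner_smul_left, inner_neg_right,
    inner_starDelta_self, inner_conj_symm]
  ring

theorem isOrthogonalSum_starExtPos_starZero (hw0 : w 0 = 0) :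
    LinRel.IsOrthogonalSum (starExtPos w) starZero
      (Submodule.span ℂ {((0 : StarSpace), starDelta 0)}) := by
  constructor
  · ext ⟨f, g⟩
    rw [mem_starExtPos hw0, Submodule.mem_sup]
    constructor
    · rintro ⟨hf, c, rfl⟩
      exact ⟨(f, 0), ⟨mem_starLeaves.2 hf, by simp⟩, _,
        Submodule.mem_span_singleton.2 ⟨c, rfl⟩, by simp⟩
    · rintro ⟨⟨a, b⟩, ⟨ha, hb⟩, y, hy, hfg⟩
      obtain ⟨t, rfl⟩ := Submodule.mem_span_singleton.1 hy
      have hb' : b = 0 := by simpa using hb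
      simp only [Prod.smul_mk, Prod.mk_add_mk, Prod.mk.injEq, hb', smul_zero, add_zero,
        zero_add] at hfg
      obtain ⟨rfl, rfl⟩ := hfg
      exact ⟨mem_starLeaves.1 ha, t, rfl⟩
  · rintro ⟨f, g⟩ ⟨_, hg⟩ q hq
    obtain ⟨t, rfl⟩ := Submodule.mem_span_singleton.1 hq
    have hg' : g = 0 := by simpa using hg
    simp [hg']

theorem ker_starExtPos (hw0 : w 0 = 0) : ((starExtPos w).subSmul 0).ker = starLeaves := by
  ext f
  rw [LinRel.mem_ker_subSmul, mem_starExtPos hw0, mem_starLeaves]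
  exact and_iff_left ⟨0, by simp⟩

theorem eq_zero_of_mem_pointSpec_starExtPos (hw0 : w 0 = 0) {ζ : ℂ}
    (h : ζ ∈ (starExtPos w).pointSpec) : ζ = 0 := by
  obtain ⟨f, hf, hfT⟩ := LinRel.mem_pointSpec.1 h
  obtain ⟨hf0, c, hc⟩ := (mem_starExtPos hw0).1 hfT
  have := congrArg (fun x => (inner ℂ (starDelta 0) x : ℂ)) hc
  simp only [inner_smul_right, hf0, inner_starDelta_self, mul_zero, mul_one] at this
  rw [← this, zero_smul] at hc
  exact (smul_eq_zero.1 hc).resolve_right hf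

theorem infPointSpec_starExtPos (hw0 : w 0 = 0) : (starExtPos w).infPointSpec = {0} := by
  refine Set.Subset.antisymm (fun ζ h => eq_zero_of_mem_pointSpec_starExtPos hw0 h.1) ?_
  rintro _ rfl
  have hinf : ¬ FiniteDimensional ℂ ((starExtPos w).subSmul 0).ker := by
    rw [ker_starExtPos hw0]
    exact Submodule.not_finiteDimensional_of_orthogonal_le not_finiteDimensional_starSpace
      (M := Submodule.span ℂ {starDelta 0}) le_rfl
  refine ⟨fun h => hinf ?_, hinf⟩
  rw [h]; infer_instance

theorem mem_regularSet_starExtPos (hw0 : w 0 = 0) {ζ : ℂ} (hζ : ζ ≠ 0) :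
    ζ ∈ (starExtPos w).regularSet := by
  -- The resolvent is `-ζ⁻¹ (I - P)`, with `P` the orthogonal projection onto `δ₀`.
  refine LinRel.mem_regularSet_of_inverse
    ((-ζ⁻¹) • (ContinuousLinearMap.id ℂ StarSpace -
      (innerSL ℂ (starDelta 0)).smulRight (starDelta 0))) ?_ ?_
  · intro f g h
    obtain ⟨hf, c, hc⟩ := (mem_starExtPos hw0).1 h
    obtain rfl : g = c • starDelta 0 - ζ • f := eq_sub_of_add_eq hc
    simp only [smul_apply, sub_apply,
      ContinuousLinearMap.id_apply, ContinuousLinearMap.smulRight_apply, innerSL_apply_apply,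
      inner_sub_right, inner_smul_right, inner_starDelta_self, hf]
    match_scalars <;> field_simp
    ring
  · intro g
    rw [mem_starExtPos hw0]
    simp only [smul_apply, sub_apply,
      ContinuousLinearMap.id_apply, ContinuousLinearMap.smulRight_apply, innerSL_apply_apply,
      inner_sub_right, inner_smul_right, inner_starDelta_self]
    refine ⟨by ring, inner ℂ (starDelta 0) g, ?_⟩
    match_scalars <;> field_simp
    ring

theorem spec_starExtPos (hw0 : w 0 = 0) : (starExtPos w).spec = {0} := by
  refine Set.Subset.antisymm (fun ζ h => ?_) ?_
  · by_contra hζ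
    exact h (mem_regularSet_starExtPos hw0 hζ)
  · rw [← infPointSpec_starExtPos hw0]
    exact fun ζ h => LinRel.pointSpec_subset_spec _ h.1

theorem contSpec_starExtPos (hw0 : w 0 = 0) : (starExtPos w).contSpec = ∅ := by
  refine Set.eq_empty_of_forall_notMem fun ζ h => h ?_
  by_cases hζ : ζ = 0
  · subst hζ
    have : ((starExtPos w).subSmul 0).ran = Submodule.span ℂ {starDelta 0} := by
      ext g
      rw [LinRel.mem_ran_subSmul, Submodule.mem_span_singleton]
      simp only [mem_starExtPos hw0, zero_smul, add_zero]
      exact ⟨fun ⟨_, _, c, hc⟩ => ⟨c, hc.symm⟩, fun ⟨c, hc⟩ => ⟨0, by simp, c, hc.symm⟩⟩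
    rw [this]
    exact Submodule.closed_of_finiteDimensional _
  · rw [LinRel.ran_eq_top_of_mem_regularSet (mem_regularSet_starExtPos hw0 hζ)]
    exact isClosed_univ

end

/-! ### The extensions `A_α` -/

section

variable {w : StarSpace} {α : ℝ}

/-- `starExt w α` is the graph of an everywhere defined bounded operator of rank two. -/
theorem mem_starExt (hw0 : w 0 = 0) {f g : StarSpace} : (f, g) ∈ starExt w α ↔
    g = (inner ℂ (starDelta 0) f : ℂ) • w + ((inner ℂ w f : ℂ) +
      ((α : ℂ) - (α : ℂ)⁻¹ * (‖w‖ : ℂ) ^ 2) * inner ℂ (starDelta 0) f) • starDelta 0 := by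
  obtain ⟨h1, h2⟩ := inner_starDelta_zero_of_apply_eq_zero hw0
  have hN : (inner ℂ w w : ℂ) = (‖w‖ : ℂ) ^ 2 := inner_self_eq_norm_sq_to_K (𝕜 := ℂ) w
  have hee := inner_starDelta_self 0
  rw [starExt, Submodule.mem_sup]
  constructor
  · rintro ⟨⟨a, b⟩, hab, y, hy, hfg⟩
    obtain ⟨t, rfl⟩ := Submodule.mem_span_singleton.1 hy
    obtain ⟨ha, rfl⟩ := mem_starAdjacency.1 hab
    simp only [Prod.smul_mk, Prod.mk_add_mk, Prod.mk.injEq] at hfg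
    obtain ⟨rfl, rfl⟩ := hfg
    simp only [inner_add_right, inner_smul_right, ha, h1, h2, hee, hN]
    module
  · rintro rfl
    -- Forced: the remaining first entry must be orthogonal to `δ₀`.
    set t : ℂ := inner ℂ (starDelta 0) f with ht
    refine ⟨(f - t • (starDelta 0 + (α : ℂ)⁻¹ • w),
        (inner ℂ w (f - t • (starDelta 0 + (α : ℂ)⁻¹ • w)) : ℂ) • starDelta 0),
      mem_starAdjacency.2 ⟨?_, rfl⟩,
      _, Submodule.mem_span_singleton.2 ⟨t, rfl⟩, ?_⟩
    · simp only [inner_sub_right, inner_add_right, inner_smul_right, h1, hee, ← ht]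
      ring
    · simp only [Prod.smul_mk, Prod.mk_add_mk, Prod.mk.injEq, sub_add_cancel, true_and,
        inner_sub_right, inner_add_right, inner_smul_right, h2, hN]
      module

theorem isSelfadjoint_starExt (hw0 : w 0 = 0) : (starExt w α).IsSelfadjoint := by
  -- The operator is symmetric because `β` is real; being defined everywhere, it then equals its
  -- adjoint.
  have hsymm : ∀ h f : StarSpace, (inner ℂ ((inner ℂ (starDelta 0) f : ℂ) • w + ((inner ℂ w f : ℂ) +
      ((α : ℂ) - (α : ℂ)⁻¹ * (‖w‖ : ℂ) ^ 2) * inner ℂ (starDelta 0) f) • starDelta 0) h : ℂ) =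
      inner ℂ f ((inner ℂ (starDelta 0) h : ℂ) • w + ((inner ℂ w h : ℂ) +
      ((α : ℂ) - (α : ℂ)⁻¹ * (‖w‖ : ℂ) ^ 2) * inner ℂ (starDelta 0) h) • starDelta 0) := by
    intro h f
    simp only [inner_add_left, inner_add_right, inner_smul_left, inner_smul_right, map_add,
      map_mul, map_sub, map_inv₀, map_pow, Complex.conj_ofReal, inner_conj_symm]
    ring
  rw [LinRel.isSelfadjoint_iff]
  intro h k
  constructor
  · intro hk f g hfg
    rw [(mem_starExt hw0).1 hk, (mem_starExt hw0).1 hfg, hsymm]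
  · intro H
    rw [mem_starExt hw0]
    refine ext_inner_left ℂ fun f => ?_
    rw [← H f _ ((mem_starExt hw0).2 rfl), hsymm]

theorem isDirectSum_starExt (w : StarSpace) (α : ℝ) (hw0 : w 0 = 0) :
    LinRel.IsDirectSum (starExt w α) (starAdjacency w)
      (Submodule.span ℂ {(starDelta 0 + (α : ℂ)⁻¹ • w, (α : ℂ) • starDelta 0 + w)}) := by
  obtain ⟨h1, _⟩ := inner_starDelta_zero_of_apply_eq_zero hw0
  refine ⟨rfl, Submodule.disjoint_def.2 ?_⟩
  intro p hp hq
  obtain ⟨t, rfl⟩ := Submodule.mem_span_singleton.1 hq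
  have := (mem_starAdjacency.1 hp).1
  simp only [inner_add_right, inner_smul_right, h1, inner_starDelta_self, mul_zero, add_zero,
    mul_one] at this
  rw [this, zero_smul]

/-- The eigenvectors of `starExt w α` to a nonzero eigenvalue `ζ` are multiples of
`δ₀ + w / ζ`. -/
theorem mem_ker_starExt (hw0 : w 0 = 0) (hα : α ≠ 0) {ζ : ℂ} (hζ : ζ ≠ 0) {f : StarSpace} :
    f ∈ ((starExt w α).subSmul ζ).ker ↔
      f = (inner ℂ (starDelta 0) f : ℂ) • (starDelta 0 + ζ⁻¹ • w) ∧
      (ζ - α) * (ζ + (α : ℂ)⁻¹ * (‖w‖ : ℂ) ^ 2) * inner ℂ (starDelta 0) f = 0 := by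
  obtain ⟨h1, h2⟩ := inner_starDelta_zero_of_apply_eq_zero hw0
  have hN : (inner ℂ w w : ℂ) = (‖w‖ : ℂ) ^ 2 := inner_self_eq_norm_sq_to_K (𝕜 := ℂ) w
  have hee := inner_starDelta_self 0
  have hα' : (α : ℂ) ≠ 0 := by exact_mod_cast hα
  rw [LinRel.mem_ker_subSmul, mem_starExt hw0]
  set t : ℂ := inner ℂ (starDelta 0) f with ht
  constructor
  · intro h
    -- The components along `δ₀` and `w` read `ζt = ⟪w, f⟫ + βt` and `ζ⟪w, f⟫ = t‖w‖²`; eliminating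
    -- `⟪w, f⟫` leaves the characteristic polynomial times `t`.
    have he := congrArg (fun x => (inner ℂ (starDelta 0) x : ℂ)) h
    have hw := congrArg (fun x => (inner ℂ w x : ℂ)) h
    simp only [inner_add_right, inner_smul_right, h1, h2, hee, hN, ← ht] at he hw
    constructor
    · have h' : f = ζ⁻¹ • (ζ • f) := by rw [smul_smul, inv_mul_cancel₀ hζ, one_smul]
      rw [h', h]
      have : (inner ℂ w f : ℂ) + ((α : ℂ) - (α : ℂ)⁻¹ * (‖w‖ : ℂ) ^ 2) * t = ζ * t := by
        linear_combination -he
      rw [this]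
      match_scalars <;> field_simp
    · have hinv := mul_inv_cancel₀ hα'
      linear_combination ζ * he + hw - (‖w‖ : ℂ) ^ 2 * t * hinv
  · rintro ⟨hf, hp⟩
    have hwf : (inner ℂ w f : ℂ) = t * (ζ⁻¹ * (‖w‖ : ℂ) ^ 2) := by
      rw [hf]
      simp only [inner_add_right, inner_smul_right, h2, hN]
      ring
    have hζt : t * (ζ⁻¹ * (‖w‖ : ℂ) ^ 2) + ((α : ℂ) - (α : ℂ)⁻¹ * (‖w‖ : ℂ) ^ 2) * t = ζ * t := by
      field_simp
      field_simp at hp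
      linear_combination -hp
    rw [hwf, hζt]
    conv_lhs => rw [hf]
    match_scalars <;> field_simp

theorem mem_starExt_eigenvector (hw0 : w 0 = 0) (hα : α ≠ 0) {ζ : ℂ} (hζ : ζ ≠ 0)
    (hp : (ζ - α) * (ζ + (α : ℂ)⁻¹ * (‖w‖ : ℂ) ^ 2) = 0) :
    starDelta 0 + ζ⁻¹ • w ∈ ((starExt w α).subSmul ζ).ker := by
  obtain ⟨h1, _⟩ := inner_starDelta_zero_of_apply_eq_zero hw0
  rw [mem_ker_starExt hw0 hα hζ, hp, inner_add_right, inner_smul_right, h1, inner_starDelta_self]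
  simp only [mul_zero, add_zero, one_smul, zero_mul, and_self]

theorem starDelta_add_smul_ne_zero (hw0 : w 0 = 0) (c : ℂ) : starDelta 0 + c • w ≠ 0 := by
  obtain ⟨h1, _⟩ := inner_starDelta_zero_of_apply_eq_zero hw0
  intro h
  have := congrArg (fun x => (inner ℂ (starDelta 0) x : ℂ)) h
  simp only [inner_add_right, inner_smul_right, h1, inner_starDelta_self, inner_zero_right,
    mul_zero, add_zero] at this
  exact one_ne_zero this

/-- A nonzero root of the characteristic polynomial is a simple eigenvalue. -/
theorem ker_starExt_eq_span (hw0 : w 0 = 0) (hα : α ≠ 0) {ζ : ℂ} (hζ : ζ ≠ 0)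
    (hp : (ζ - α) * (ζ + (α : ℂ)⁻¹ * (‖w‖ : ℂ) ^ 2) = 0) :
    ((starExt w α).subSmul ζ).ker = Submodule.span ℂ {starDelta 0 + ζ⁻¹ • w} := by
  refine le_antisymm (fun f hf => ?_) ?_
  · exact Submodule.mem_span_singleton.2 ⟨_, ((mem_ker_starExt hw0 hα hζ).1 hf).1.symm⟩
  · rw [Submodule.span_singleton_le_iff_mem]
    exact mem_starExt_eigenvector hw0 hα hζ hp

theorem ker_starExt_eq_bot (hw0 : w 0 = 0) (hα : α ≠ 0) {ζ : ℂ} (hζ : ζ ≠ 0)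
    (hp : (ζ - α) * (ζ + (α : ℂ)⁻¹ * (‖w‖ : ℂ) ^ 2) ≠ 0) :
    ((starExt w α).subSmul ζ).ker = ⊥ := by
  rw [Submodule.eq_bot_iff]
  intro f hf
  obtain ⟨hf, h⟩ := (mem_ker_starExt hw0 hα hζ).1 hf
  rw [(mul_eq_zero.1 h).resolve_left hp, zero_smul] at hf
  exact hf

theorem not_finiteDimensional_ker_starExt_zero (hw0 : w 0 = 0) :
    ¬ FiniteDimensional ℂ ((starExt w α).subSmul 0).ker := by
  have : FiniteDimensional ℂ (Submodule.span ℂ {starDelta 0, w}) :=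
    FiniteDimensional.span_of_finite ℂ (Set.toFinite _)
  refine Submodule.not_finiteDimensional_of_orthogonal_le not_finiteDimensional_starSpace
    (M := Submodule.span ℂ {starDelta 0, w}) fun f hf => ?_
  have he : (inner ℂ (starDelta 0) f : ℂ) = 0 := hf _ (Submodule.subset_span (by simp))
  have hw : (inner ℂ w f : ℂ) = 0 := hf _ (Submodule.subset_span (by simp))
  rw [LinRel.mem_ker_subSmul, mem_starExt hw0, he, hw]
  simp

theorem mem_regularSet_starExt (hw0 : w 0 = 0) (hα : α ≠ 0) {ζ : ℂ} (hζ : ζ ≠ 0)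
    (hp : (ζ - α) * (ζ + (α : ℂ)⁻¹ * (‖w‖ : ℂ) ^ 2) ≠ 0) :
    ζ ∈ (starExt w α).regularSet := by
  obtain ⟨h1, h2⟩ := inner_starDelta_zero_of_apply_eq_zero hw0
  have hN : (inner ℂ w w : ℂ) = (‖w‖ : ℂ) ^ 2 := inner_self_eq_norm_sq_to_K (𝕜 := ℂ) w
  have hee := inner_starDelta_self 0
  have hα' : (α : ℂ) ≠ 0 := by exact_mod_cast hα
  have hinv := mul_inv_cancel₀ hα'
  have hζinv := mul_inv_cancel₀ hζ
  set p : ℂ := (ζ - α) * (ζ + (α : ℂ)⁻¹ * (‖w‖ : ℂ) ^ 2) with hpdef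
  have hpinv := mul_inv_cancel₀ hp
  -- the functional computing the `δ₀`-coefficient of the resolvent
  set φ : StarSpace →L[ℂ] ℂ := (-p⁻¹) • (ζ • innerSL ℂ (starDelta 0) + innerSL ℂ w) with hφ
  -- Solve the equation for `f = R g`, with `φ g = ⟪δ₀, f⟫`; its `δ₀`-component turns `⟪w, f⟫ +
  -- β⟪δ₀, f⟫` into `⟪δ₀, g⟫ + ζ φ g`.
  set R : StarSpace →L[ℂ] StarSpace :=
    ζ⁻¹ • (φ.smulRight w + (innerSL ℂ (starDelta 0) + ζ • φ).smulRight (starDelta 0) -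
      ContinuousLinearMap.id ℂ StarSpace) with hR
  have hRapp : ∀ g, R g = ζ⁻¹ • (φ g • w + ((inner ℂ (starDelta 0) g : ℂ) + ζ * φ g) •
      starDelta 0 - g) := fun g => by
    simp [hR]
  have hφapp : ∀ g, φ g = -p⁻¹ * (ζ * inner ℂ (starDelta 0) g + inner ℂ w g) := fun g => by
    simp only [hφ, smul_apply, add_apply, innerSL_apply_apply, smul_eq_mul]
  have hright : ∀ g, (R g, g + ζ • R g) ∈ starExt w α := by
    intro g
    have hpφ : p * φ g = -(ζ * inner ℂ (starDelta 0) g + inner ℂ w g) := by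
      rw [hφapp]; linear_combination -(ζ * inner ℂ (starDelta 0) g + inner ℂ w g) * hpinv
    have heR : (inner ℂ (starDelta 0) (R g) : ℂ) = φ g := by
      rw [hRapp]
      simp only [inner_sub_right, inner_add_right, inner_smul_right, h1, hee]
      linear_combination φ g * hζinv
    have hwR : ζ * (inner ℂ w (R g) : ℂ) = φ g * (‖w‖ : ℂ) ^ 2 - inner ℂ w g := by
      rw [hRapp]
      simp only [inner_sub_right, inner_add_right, inner_smul_right, h2, hN]
      linear_combination (φ g * (‖w‖ : ℂ) ^ 2 - inner ℂ w g) * hζinv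
    have hcoef : (inner ℂ w (R g) : ℂ) + ((α : ℂ) - (α : ℂ)⁻¹ * (‖w‖ : ℂ) ^ 2) * φ g =
        inner ℂ (starDelta 0) g + ζ * φ g := by
      refine mul_left_cancel₀ hζ ?_
      rw [hpdef] at hpφ
      linear_combination hwR - hpφ - (‖w‖ : ℂ) ^ 2 * φ g * hinv
    rw [mem_starExt hw0, heR, hcoef, hRapp, smul_smul, hζinv]
    module
  refine LinRel.mem_regularSet_of_inverse R (fun f g h => ?_) hright
  -- A right inverse is also a left inverse because the kernel is trivial.
  have hdiff : f - R g ∈ ((starExt w α).subSmul ζ).ker := by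
    rw [LinRel.mem_ker_subSmul]
    have := (starExt w α).sub_mem h (hright g)
    rw [Prod.mk_sub_mk] at this
    convert this using 2
    module
  rw [ker_starExt_eq_bot hw0 hα hζ hp, Submodule.mem_bot] at hdiff
  exact sub_eq_zero.1 hdiff

theorem starExt_charpoly_eq_zero_iff {ζ : ℂ} :
    (ζ - α) * (ζ + (α : ℂ)⁻¹ * (‖w‖ : ℂ) ^ 2) = 0 ↔
      ζ = α ∨ ζ = ((-‖w‖ ^ 2 / α : ℝ) : ℂ) := by
  have : ((-‖w‖ ^ 2 / α : ℝ) : ℂ) = -((α : ℂ)⁻¹ * (‖w‖ : ℂ) ^ 2) := by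
    push_cast; ring
  rw [mul_eq_zero, sub_eq_zero, this, add_eq_zero_iff_eq_neg]

theorem ne_zero_of_starExt_charpoly (hw : w ≠ 0) (hα : α ≠ 0) {ζ : ℂ}
    (h : ζ = α ∨ ζ = ((-‖w‖ ^ 2 / α : ℝ) : ℂ)) : ζ ≠ 0 := by
  have := norm_ne_zero_iff.2 hw
  rcases h with rfl | rfl
  · exact_mod_cast hα
  · have : -‖w‖ ^ 2 / α ≠ 0 := div_ne_zero (neg_ne_zero.2 (pow_ne_zero 2 this)) hα
    exact_mod_cast this

theorem discreteSpec_starExt (hw0 : w 0 = 0) (hw : w ≠ 0) (hα : α ≠ 0) :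
    (starExt w α).discreteSpec = {(α : ℂ), ((-‖w‖ ^ 2 / α : ℝ) : ℂ)} := by
  ext ζ
  constructor
  · rintro ⟨h1, h2⟩
    have hζ : ζ ≠ 0 := by
      rintro rfl
      exact not_finiteDimensional_ker_starExt_zero hw0 h2
    by_contra hne
    refine h1 (ker_starExt_eq_bot hw0 hα hζ fun hp => hne ?_)
    simpa using (starExt_charpoly_eq_zero_iff).1 hp
  · intro h
    have h' : ζ = α ∨ ζ = ((-‖w‖ ^ 2 / α : ℝ) : ℂ) := h
    have hζ := ne_zero_of_starExt_charpoly hw hα h'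
    have hker := ker_starExt_eq_span hw0 hα hζ ((starExt_charpoly_eq_zero_iff).2 h')
    refine ⟨?_, ?_⟩
    · change ((starExt w α).subSmul ζ).ker ≠ ⊥
      rw [hker, Ne, Submodule.span_singleton_eq_bot]
      exact starDelta_add_smul_ne_zero hw0 _
    · rw [hker]; infer_instance

theorem finrank_ker_starExt (hw0 : w 0 = 0) (hw : w ≠ 0) (hα : α ≠ 0) {ζ : ℂ}
    (h : ζ ∈ (starExt w α).discreteSpec) :
    Module.finrank ℂ ((starExt w α).subSmul ζ).ker = 1 := by
  rw [discreteSpec_starExt hw0 hw hα] at h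
  have h' : ζ = α ∨ ζ = ((-‖w‖ ^ 2 / α : ℝ) : ℂ) := h
  rw [ker_starExt_eq_span hw0 hα (ne_zero_of_starExt_charpoly hw hα h')
    ((starExt_charpoly_eq_zero_iff).2 h')]
  exact finrank_span_singleton (starDelta_add_smul_ne_zero hw0 _)

theorem infPointSpec_starExt (hw0 : w 0 = 0) (hα : α ≠ 0) :
    (starExt w α).infPointSpec = {0} := by
  ext ζ
  constructor
  · rintro ⟨h1, h2⟩
    by_contra hζ
    by_cases hp : (ζ - α) * (ζ + (α : ℂ)⁻¹ * (‖w‖ : ℂ) ^ 2) = 0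
    · rw [ker_starExt_eq_span hw0 hα hζ hp] at h2
      exact h2 inferInstance
    · exact h1 (ker_starExt_eq_bot hw0 hα hζ hp)
  · rintro rfl
    have hinf := not_finiteDimensional_ker_starExt_zero (α := α) hw0
    refine ⟨fun h => hinf ?_, hinf⟩
    rw [h]; infer_instance

theorem spec_starExt (hw0 : w 0 = 0) (hw : w ≠ 0) (hα : α ≠ 0) :
    (starExt w α).spec = {0, (α : ℂ), ((-‖w‖ ^ 2 / α : ℝ) : ℂ)} := by
  refine Set.Subset.antisymm (fun ζ h => ?_) ?_
  · by_contra hne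
    simp only [Set.mem_insert_iff, Set.mem_singleton_iff, not_or] at hne
    exact h (mem_regularSet_starExt hw0 hα hne.1 fun hp =>
      not_or.2 hne.2 ((starExt_charpoly_eq_zero_iff).1 hp))
  · refine Set.insert_subset ?_ ?_
    · exact LinRel.pointSpec_subset_spec _
        (show (0 : ℂ) ∈ (starExt w α).infPointSpec by rw [infPointSpec_starExt hw0 hα]; rfl).1
    · rw [← discreteSpec_starExt hw0 hw hα]
      exact fun ζ h => LinRel.pointSpec_subset_spec _ h.1

/-- Shows that the range is closed at the two simple eigenvalues, where no resolvent exists. -/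
theorem ran_starExt_eq_orthogonal (hw0 : w 0 = 0) (hα : α ≠ 0) {ζ : ℂ} (hζ : ζ ≠ 0)
    (hreal : starRingEnd ℂ ζ = ζ) (hp : (ζ - α) * (ζ + (α : ℂ)⁻¹ * (‖w‖ : ℂ) ^ 2) = 0) :
    ((starExt w α).subSmul ζ).ran = (Submodule.span ℂ {starDelta 0 + ζ⁻¹ • w})ᗮ := by
  obtain ⟨h1, h2⟩ := inner_starDelta_zero_of_apply_eq_zero hw0
  have hee := inner_starDelta_self 0
  ext g
  rw [LinRel.mem_ran_subSmul, Submodule.mem_orthogonal_singleton_iff_inner_right]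
  constructor
  · rintro ⟨f, hf⟩
    have hv := LinRel.mem_ker_subSmul.1 (mem_starExt_eigenvector hw0 hα hζ hp)
    have := (isSelfadjoint_starExt hw0).inner_eq hv hf
    rw [inner_smul_left, hreal, inner_add_right, inner_smul_right] at this
    linear_combination -this
  · intro hg
    rw [inner_add_left, inner_smul_left, map_inv₀, hreal] at hg
    have hζinv := mul_inv_cancel₀ hζ
    -- The preimage normalised, modulo the eigenvector, to be orthogonal to `δ₀`; orthogonality of
    -- `g` to the eigenvector is exactly its solvability condition.
    refine ⟨ζ⁻¹ • ((inner ℂ (starDelta 0) g : ℂ) • starDelta 0 - g), ?_⟩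
    have hcoef : ζ⁻¹ * ((inner ℂ (starDelta 0) g : ℂ) * 0 - inner ℂ w g) =
        inner ℂ (starDelta 0) g := by
      linear_combination -hg
    rw [mem_starExt hw0]
    simp only [inner_sub_right, inner_smul_right, h2, hee]
    rw [hcoef, smul_smul, hζinv]
    module

theorem contSpec_starExt (hw0 : w 0 = 0) (hα : α ≠ 0) : (starExt w α).contSpec = ∅ := by
  refine Set.eq_empty_of_forall_notMem fun ζ h => h ?_
  by_cases hζ : ζ = 0
  · subst hζ
    have : FiniteDimensional ℂ (Submodule.span ℂ {w, starDelta 0}) :=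
      FiniteDimensional.span_of_finite ℂ (Set.toFinite _)
    -- At `0` the range is closed because it is finite-dimensional.
    have hle : ((starExt w α).subSmul 0).ran ≤ Submodule.span ℂ {w, starDelta 0} := by
      intro g hg
      obtain ⟨f, hf⟩ := LinRel.mem_ran_subSmul.1 hg
      rw [zero_smul, add_zero] at hf
      exact Submodule.mem_span_pair.2 ⟨_, _, ((mem_starExt hw0).1 hf).symm⟩
    have : FiniteDimensional ℂ ((starExt w α).subSmul 0).ran :=
      Submodule.finiteDimensional_of_le hle
    exact Submodule.closed_of_finiteDimensional _
  · by_cases hp : (ζ - α) * (ζ + (α : ℂ)⁻¹ * (‖w‖ : ℂ) ^ 2) = 0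
    · have hreal : starRingEnd ℂ ζ = ζ := by
        rcases (starExt_charpoly_eq_zero_iff).1 hp with rfl | rfl <;>
          exact Complex.conj_ofReal _
      rw [ran_starExt_eq_orthogonal hw0 hα hζ hreal hp]
      exact Submodule.isClosed_orthogonal _
    · rw [LinRel.ran_eq_top_of_mem_regularSet (mem_regularSet_starExt hw0 hα hζ hp)]
      exact isClosed_univ

theorem eq_starExt_of_mem_pointSpec (hw0 : w 0 = 0) (hα : α ≠ 0) {S : LinRel StarSpace}
    (hAS : starAdjacency w ≤ S) (hS : S.IsSelfadjoint) (hpt : (α : ℂ) ∈ S.pointSpec) :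
    S = starExt w α := by
  obtain ⟨h1, _⟩ := inner_starDelta_zero_of_apply_eq_zero hw0
  have hα' : (α : ℂ) ≠ 0 := by exact_mod_cast hα
  obtain ⟨h, hne, hhS⟩ := LinRel.mem_pointSpec.1 hpt
  obtain ⟨c, hc⟩ := eq_of_starAdjacency_le hAS hS hhS
  set t : ℂ := inner ℂ (starDelta 0) h with ht
  have hct : (α : ℂ) * t = c := by
    have := congrArg (fun x => (inner ℂ (starDelta 0) x : ℂ)) hc
    simpa only [inner_add_right, inner_smul_right, h1, inner_starDelta_self, ← ht, mul_zero,
      zero_add, mul_one] using this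
  have hh : h = t • (starDelta 0 + (α : ℂ)⁻¹ • w) := by
    have h' : h = (α : ℂ)⁻¹ • ((α : ℂ) • h) := by rw [smul_smul, inv_mul_cancel₀ hα', one_smul]
    rw [h', hc, ← hct]
    match_scalars <;> field_simp
  have ht0 : t ≠ 0 := by
    intro h0
    rw [h0, zero_smul] at hh
    exact hne hh
  refine (isSelfadjoint_starExt hw0).eq_of_le hS (sup_le hAS ?_)
  rw [Submodule.span_singleton_le_iff_mem]
  -- Rescaling the eigenpair by `t⁻¹` yields the generator of `A_α`.
  have := S.smul_mem t⁻¹ hhS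
  rw [hc, ← hct, hh] at this
  convert this using 1
  rw [Prod.smul_mk]
  congr 1
  · rw [smul_smul, inv_mul_cancel₀ ht0, one_smul]
  · match_scalars <;> field_simp

end

theorem mainTheorem11 (w : StarSpace) (hw0 : w 0 = 0) (hw : ∀ j : ℕ, 1 ≤ j → w j ≠ 0) :
    -- the unique positive selfadjoint extension
    (starAdjacency w ≤ starExtPos w ∧ (starExtPos w).IsSelfadjoint ∧ (starExtPos w).IsPositive ∧
      (∀ S : LinRel StarSpace,
        starAdjacency w ≤ S → S.IsSelfadjoint → S.IsPositive → S = starExtPos w) ∧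
      (starExtPos w).IsQuasiNull ∧
      LinRel.IsOrthogonalSum (starExtPos w) (starAdjacency w)
        (Submodule.span ℂ {(w, -starDelta 0)}) ∧
      LinRel.IsOrthogonalSum (starExtPos w) starZero
        (Submodule.span ℂ {((0 : StarSpace), starDelta 0)}) ∧
      (starExtPos w).infPointSpec = {0} ∧ (starExtPos w).spec = {0} ∧
      (starExtPos w).contSpec = ∅) ∧
    -- the unique selfadjoint extension with a prescribed eigenvalue `α ≠ 0`
    (∀ α : ℝ, α ≠ 0 →
      starAdjacency w ≤ starExt w α ∧ (starExt w α).IsSelfadjoint ∧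
      LinRel.IsDirectSum (starExt w α) (starAdjacency w)
        (Submodule.span ℂ {(starDelta 0 + (α : ℂ)⁻¹ • w, (α : ℂ) • starDelta 0 + w)}) ∧
      (α : ℂ) ∈ (starExt w α).pointSpec ∧
      (∀ S : LinRel StarSpace,
        starAdjacency w ≤ S → S.IsSelfadjoint → (α : ℂ) ∈ S.pointSpec → S = starExt w α) ∧
      (starExt w α).discreteSpec = {(α : ℂ), ((-‖w‖ ^ 2 / α : ℝ) : ℂ)} ∧
      (∀ ζ ∈ (starExt w α).discreteSpec,
        Module.finrank ℂ ((starExt w α).subSmul ζ).ker = 1) ∧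
      (starExt w α).infPointSpec = {0} ∧
      (starExt w α).contSpec = ∅ ∧
      (starExt w α).spec = {0, (α : ℂ), ((-‖w‖ ^ 2 / α : ℝ) : ℂ)}) := by
  have hw' : w ≠ 0 := by
    rintro rfl
    exact hw 1 le_rfl rfl
  refine ⟨⟨le_sup_left, isSelfadjoint_starExtPos hw0, fun p hp => ?_, fun S =>
    eq_starExtPos_of_isPositive hw0 hw', isQuasiNull_starExtPos hw0,
    isOrthogonalSum_starExtPos_starAdjacency w, isOrthogonalSum_starExtPos_starZero hw0,
    infPointSpec_starExtPos hw0, spec_starExtPos hw0, contSpec_starExtPos hw0⟩, fun α hα =>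
    ⟨le_sup_left, isSelfadjoint_starExt hw0, isDirectSum_starExt w α hw0, ?_, fun S =>
    eq_starExt_of_mem_pointSpec hw0 hα, discreteSpec_starExt hw0 hw' hα, fun ζ =>
    finrank_ker_starExt hw0 hw' hα, infPointSpec_starExt hw0 hα, contSpec_starExt hw0 hα,
    spec_starExt hw0 hw' hα⟩⟩
  · rw [isQuasiNull_starExtPos hw0 p hp]; simp
  · have : (α : ℂ) ∈ (starExt w α).discreteSpec := by
      rw [discreteSpec_starExt hw0 hw' hα]; exact Set.mem_insert _ _
    exact this.1
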